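/- Let $n\ge 1$ and let $V\in L^\infty_{loc}(\mathbb R^n)$ be real-valued. Assume that there is some $r>0$ such that $V\ge 0$ almost everywhere on $\{|x|>r\}$, $$\int_{|x|>r}\frac{1}{|x|^{n+2}\,V(x)}\,dx<\infty\qquad\text{and}\qquad \int_{|x|>r}|x|^{4-2n}\,V(x)\,dx=\infty ,$$ where $1/0=\infty$. A weak solution of $-\Delta u=Vu$ on $\mathbb R^n$ is a real-valued function $u\in L^1_{loc}(\mathbb R^n)$ with $Vu\in L^1_{loc}(\mathbb R^n)$ and $-\int_{\mathbb R^n} u\,\Delta\varphi\,dx=\int_{\mathbb R^n} V u\,\varphi\,dx$ for all $\varphi\in C_c^\infty(\mathbb R^n)$. Then: 1. If $u\in L^\infty(\mathbb R^n)$ is a weak solution of $-\Delta u=Vu$ on $\mathbb R^n$, and there is $R$ such that $u\ge 0$ a.e. on $\{|x|>R\}$ or $u\le 0$ a.e. on $\{|x|>R\}$, then $u=0$ a.e. on $\mathbb R^n$. 2. Consequently every weak solution $u\in L^\infty(\mathbb R^n)$ of $-\Delta u=Vu$ on $\mathbb R^n$ that is not a.e. equal to a constant changes sign near infinity: for every $R$,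 both $\{|x|>R,\ u>0\}$ and $\{|x|>R,\ u<0\}$ have positive measure. -/

import Mathlib

open MeasureTheory

open scoped ContDiff

/-- `f ∈ L^∞_loc(ℝⁿ)`: measurable (up to null sets) and essentially bounded on every compact set. -/
def IsLinftyLoc {n : ℕ} (f : EuclideanSpace ℝ (Fin n) → ℝ) : Prop :=
  AEStronglyMeasurable f volume ∧
    ∀ K : Set (EuclideanSpace ℝ (Fin n)), IsCompact K → MemLp f ⊤ (volume.restrict K)

/-- `u` is a weak (distributional) solution of `-Δ u = V u` on `ℝⁿ`: both `u` and `V u` are locally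
integrable, and the equation holds when tested against every `φ ∈ C_c^∞(ℝⁿ)`. -/
structure IsWeakSolution {n : ℕ} (V u : EuclideanSpace ℝ (Fin n) → ℝ) : Prop where
  locallyIntegrable : LocallyIntegrable u volume
  locallyIntegrable_mul : LocallyIntegrable (fun x => V x * u x) volume
  weak_eq : ∀ φ : EuclideanSpace ℝ (Fin n) → ℝ, ContDiff ℝ ∞ φ → HasCompactSupport φ →
    -(∫ x, u x * Laplacian.laplacian φ x) = ∫ x, V x * u x * φ x

/-- `f ≥ 0` (a.e.) when `|x|` is large. -/
def NonnegNearInfinity {n : ℕ} (f : EuclideanSpace ℝ (Fin n) → ℝ) : Prop :=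
  ∃ R : ℝ, ∀ᵐ x, R < ‖x‖ → 0 ≤ f x

/-- `f ≤ 0` (a.e.) when `|x|` is large. -/
def NonposNearInfinity {n : ℕ} (f : EuclideanSpace ℝ (Fin n) → ℝ) : Prop :=
  ∃ R : ℝ, ∀ᵐ x, R < ‖x‖ → f x ≤ 0

/-- `f` changes sign near infinity: outside every ball it is positive on a set of positive measure
and negative on a set of positive measure. -/
def ChangesSignNearInfinity {n : ℕ} (f : EuclideanSpace ℝ (Fin n) → ℝ) : Prop :=
  ∀ R : ℝ, 0 < volume {x : EuclideanSpace ℝ (Fin n) | R < ‖x‖ ∧ 0 < f x} ∧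
    0 < volume {x : EuclideanSpace ℝ (Fin n) | R < ‖x‖ ∧ f x < 0}

/-!
A nonnegative solution `u` of `-Δ u = V u` with `V ≥ 0` on a ball of radius `6 s` is superharmonic
there, so on the ball of radius `s` it is bounded below by a multiple of `s⁻ⁿ ∫ u`: its radial
averages decrease with the radius. Testing the equation with a bump function bounds `∫ V u` by a
multiple of `s⁻² ∫ u`, so that `∫ V ≤ C s^(n - 2)` on the ball of radius `s` unless `u` vanishes
on the ball of radius `2 s`. By Cauchy–Schwarz the scale-invariant integral of
`1 / (|x|^(n + 2) V)` over a ball of radius `s` at distance `7 s` from the origin is then bounded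
below, which its convergence at infinity excludes for large `s`. Hence `u` vanishes near infinity.

For the compactly supported `u`, testing the equation with complex exponentials shows that
`4 π τ |⟪e, ξ⟫|` times the Fourier transform of `exp (τ ⟪e, x⟫) u` is bounded by that of
`exp (τ ⟪e, x⟫) V u`. If `|e|` exceeds the diameter of the support, then translation by `e` makes
the supports disjoint, so the multiplier `⟪e, ξ⟫` is bounded below and Plancherel gives
`‖exp (τ ⟪e, x⟫) u‖₂ ≤ (2 τ)⁻¹ ‖exp (τ ⟪e, x⟫) V u‖₂`, which forces `u = 0` for large `τ`.
-/

open Metric Set Filter Topology Module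
open scoped Laplacian

section Laplacian

variable {E F : Type*} [NormedAddCommGroup E] [InnerProductSpace ℝ E]
  [NormedAddCommGroup F] [NormedSpace ℝ F]

theorem laplacian_eq_sum_of_hasFDerivAt [FiniteDimensional ℝ E] {ι : Type*} [Fintype ι]
    (b : OrthonormalBasis ι ℝ E) {f : E → F} {f' : E → E →L[ℝ] F} {f'' : E →L[ℝ] E →L[ℝ] F}
    {x : E} (hf : ∀ᶠ y in 𝓝 x, HasFDerivAt f (f' y) y) (hf' : HasFDerivAt f' f'' x) :
    Δ f x = ∑ i, f'' (b i) (b i) := by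
  have hfderiv : fderiv ℝ f =ᶠ[𝓝 x] f' := hf.mono fun y hy => hy.fderiv
  simp [InnerProductSpace.laplacian_eq_iteratedFDeriv_orthonormalBasis f b,
    iteratedFDeriv_two_apply, hfderiv.fderiv_eq, hf'.fderiv]

theorem hasFDerivAt_norm_sub_sq (x y : E) :
    HasFDerivAt (fun z => ‖z - x‖ ^ 2) ((2 : ℝ) • innerSL ℝ (y - x)) y := by
  simpa [Function.comp_def, two_smul] using
    (hasStrictFDerivAt_norm_sq (y - x)).hasFDerivAt.comp y ((hasFDerivAt_id y).sub_const x)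

theorem laplacian_comp_norm_sub_sq [FiniteDimensional ℝ E] {f f' : ℝ → ℝ} {f'' : ℝ} {x y : E}
    (hf : ∀ t, HasDerivAt f (f' t) t) (hf' : HasDerivAt f' f'' (‖y - x‖ ^ 2)) :
    Δ (fun z => f (‖z - x‖ ^ 2)) y =
      2 * finrank ℝ E * f' (‖y - x‖ ^ 2) + 4 * ‖y - x‖ ^ 2 * f'' := by
  let b := stdOrthonormalBasis ℝ E
  have hfirst (z : E) : HasFDerivAt (fun z => f (‖z - x‖ ^ 2))
      ((2 * f' (‖z - x‖ ^ 2)) • innerSL ℝ (z - x)) z := by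
    simpa [Function.comp_def, smul_smul, mul_comm] using
      (hf (‖z - x‖ ^ 2)).comp_hasFDerivAt z (hasFDerivAt_norm_sub_sq x z)
  have hsecond : HasFDerivAt (fun z => (2 * f' (‖z - x‖ ^ 2)) • innerSL ℝ (z - x)) _ y :=
    ((hf'.comp_hasFDerivAt y (hasFDerivAt_norm_sub_sq x y)).const_mul 2).smul
      ((innerSL ℝ).hasFDerivAt.comp y ((hasFDerivAt_id y).sub_const x))
  have hnorm : ‖y - x‖ ^ 2 = ∑ i, inner ℝ (y - x) (b i) ^ 2 :=
    (b.sum_sq_inner_left (y - x)).symm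
  have hunit (i) : innerSL ℝ (b i) (b i) = (1 : ℝ) := by simp
  rw [laplacian_eq_sum_of_hasFDerivAt b (Eventually.of_forall hfirst) hsecond]
  calc _ = ∑ i, (2 * f' (‖y - x‖ ^ 2) + 4 * f'' * inner ℝ (y - x) (b i) ^ 2) := by
        refine Finset.sum_congr rfl fun i _ => ?_
        simp only [add_apply, smul_apply, ContinuousLinearMap.smulRight_apply,
          ContinuousLinearMap.comp_apply, ContinuousLinearMap.id_apply, Function.comp_apply,
          hunit, innerSL_apply_apply, smul_eq_mul]
        ring
    _ = finrank ℝ E * (2 * f' (‖y - x‖ ^ 2)) + 4 * f'' * ‖y - x‖ ^ 2 := by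
        rw [Finset.sum_add_distrib, Finset.sum_const, ← Finset.mul_sum, hnorm]
        simp
    _ = _ := by ring

theorem laplacian_cexp_clm [FiniteDimensional ℝ E] {ι : Type*} [Fintype ι]
    (b : OrthonormalBasis ι ℝ E) (ℓ : E →L[ℝ] ℂ) (x : E) :
    Δ (fun z => Complex.exp (ℓ z)) x = (∑ i, ℓ (b i) ^ 2) * Complex.exp (ℓ x) := by
  have hfirst (z : E) : HasFDerivAt (fun z => Complex.exp (ℓ z)) (Complex.exp (ℓ z) • ℓ) z :=
    ℓ.hasFDerivAt.cexp
  have hsecond : HasFDerivAt (fun z => Complex.exp (ℓ z) • ℓ) _ x := (hfirst x).smul_const ℓ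
  rw [laplacian_eq_sum_of_hasFDerivAt b (Eventually.of_forall hfirst) hsecond, Finset.sum_mul]
  refine Finset.sum_congr rfl fun i _ => ?_
  simp only [ContinuousLinearMap.smulRight_apply, smul_apply, smul_eq_mul]
  ring

end Laplacian

section Profile

/-- The first derivative of `expNegInvGlue`, the profile of the averaging kernels below. -/
noncomputable def glueDeriv (t : ℝ) : ℝ := t⁻¹ ^ 2 * expNegInvGlue t

/-- The second derivative of `expNegInvGlue`. -/
noncomputable def glueDerivTwo (t : ℝ) : ℝ := t⁻¹ ^ 2 * (t⁻¹ ^ 2 - 2 * t⁻¹) * expNegInvGlue t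

theorem hasDerivAt_expNegInvGlue (t : ℝ) : HasDerivAt expNegInvGlue (glueDeriv t) t := by
  simpa [glueDeriv] using expNegInvGlue.hasDerivAt_polynomial_eval_inv_mul 1 t

theorem hasDerivAt_glueDeriv (t : ℝ) : HasDerivAt glueDeriv (glueDerivTwo t) t := by
  have h := expNegInvGlue.hasDerivAt_polynomial_eval_inv_mul (Polynomial.X ^ 2) t
  simp only [Polynomial.eval_pow, Polynomial.eval_X] at h
  exact h.congr_deriv (by simp [glueDerivTwo, one_add_one_eq_two])

@[fun_prop]
theorem continuous_glueDeriv : Continuous glueDeriv :=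
  continuous_iff_continuousAt.2 fun t => (hasDerivAt_glueDeriv t).continuousAt

@[fun_prop]
theorem continuous_glueDerivTwo : Continuous glueDerivTwo :=
  (expNegInvGlue.continuous_polynomial_eval_inv_mul
    (Polynomial.X ^ 2 * (Polynomial.X ^ 2 - 2 * Polynomial.X))).congr
      fun t => by simp [glueDerivTwo]

theorem glueDeriv_of_nonpos {t : ℝ} (ht : t ≤ 0) : glueDeriv t = 0 := by
  simp [glueDeriv, expNegInvGlue.zero_of_nonpos ht]

theorem glueDerivTwo_of_nonpos {t : ℝ} (ht : t ≤ 0) : glueDerivTwo t = 0 := by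
  simp [glueDerivTwo, expNegInvGlue.zero_of_nonpos ht]

theorem glueDeriv_nonneg (t : ℝ) : 0 ≤ glueDeriv t :=
  mul_nonneg (sq_nonneg _) (expNegInvGlue.nonneg t)

theorem glueDeriv_pos {t : ℝ} (ht : 0 < t) : 0 < glueDeriv t :=
  mul_pos (by positivity) (expNegInvGlue.pos_of_pos ht)

theorem exists_forall_abs_le_of_eq_zero_of_nonpos {f : ℝ → ℝ} (hf : Continuous f)
    (hzero : ∀ t ≤ 0, f t = 0) (b : ℝ) : ∃ M : ℝ, 0 < M ∧ ∀ t ≤ b, |f t| ≤ M := by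
  obtain ⟨M, hM⟩ := isCompact_Icc.exists_bound_of_continuousOn (s := Icc 0 b) hf.continuousOn
  refine ⟨max 1 M, by positivity, fun t ht => ?_⟩
  rcases le_total t 0 with h | h
  · simp [hzero t h]
  · exact (hM t ⟨h, ht⟩).trans (le_max_right _ _)

theorem exists_pos_le_glueDeriv {a : ℝ} (ha : 0 < a) (b : ℝ) :
    ∃ m : ℝ, 0 < m ∧ ∀ t ∈ Icc a b, m ≤ glueDeriv t := by
  rcases (Icc a b).eq_empty_or_nonempty with hab | hab
  · exact ⟨1, one_pos, by simp [hab]⟩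
  obtain ⟨t, ht, hmin⟩ := isCompact_Icc.exists_isMinOn hab continuous_glueDeriv.continuousOn
  exact ⟨glueDeriv t, glueDeriv_pos (ha.trans_le ht.1), fun s hs => hmin hs⟩

end Profile

section RadialBump

variable {E : Type*} [NormedAddCommGroup E]

/-- A radial bump centred at `x`, positive exactly on the open ball of radius `δ` and smooth when
the norm comes from an inner product. -/
noncomputable def radialBump (x : E) (δ : ℝ) (y : E) : ℝ :=
  expNegInvGlue (1 - ‖y - x‖ ^ 2 / δ ^ 2)

theorem one_sub_norm_sq_div_nonpos {x y : E} {δ : ℝ} (hδ : 0 < δ) (hy : y ∉ ball x δ) :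
    1 - ‖y - x‖ ^ 2 / δ ^ 2 ≤ 0 := by
  rw [mem_ball_iff_norm, not_lt] at hy
  rw [sub_nonpos, one_le_div (by positivity)]
  gcongr

theorem one_sub_norm_sq_div_le_one (x y : E) (δ : ℝ) : 1 - ‖y - x‖ ^ 2 / δ ^ 2 ≤ 1 :=
  sub_le_self _ (by positivity)

theorem one_sub_sq_le_of_mem_closedBall {x y : E} {c δ : ℝ} (hδ : 0 < δ)
    (hy : y ∈ closedBall x (c * δ)) : 1 - c ^ 2 ≤ 1 - ‖y - x‖ ^ 2 / δ ^ 2 := by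
  rw [mem_closedBall_iff_norm] at hy
  refine sub_le_sub_left ?_ 1
  rw [← div_pow]
  exact pow_le_pow_left₀ (by positivity) ((div_le_iff₀ hδ).2 hy) 2

theorem radialBump_nonneg (x : E) (δ : ℝ) (y : E) : 0 ≤ radialBump x δ y :=
  expNegInvGlue.nonneg _

theorem radialBump_of_notMem_ball {x y : E} {δ : ℝ} (hδ : 0 < δ) (hy : y ∉ ball x δ) :
    radialBump x δ y = 0 :=
  expNegInvGlue.zero_of_nonpos (one_sub_norm_sq_div_nonpos hδ hy)

theorem tsupport_radialBump_subset {x : E} {δ : ℝ} (hδ : 0 < δ) :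
    tsupport (radialBump x δ) ⊆ closedBall x δ :=
  closure_minimal (fun _ hy => ball_subset_closedBall (by_contra fun h =>
    hy (radialBump_of_notMem_ball hδ h))) isClosed_closedBall

theorem hasCompactSupport_radialBump [ProperSpace E] {x : E} {δ : ℝ} (hδ : 0 < δ) :
    HasCompactSupport (radialBump x δ) :=
  HasCompactSupport.of_support_subset_isCompact (isCompact_closedBall x δ)
    ((subset_tsupport _).trans (tsupport_radialBump_subset hδ))

variable [InnerProductSpace ℝ E]

theorem contDiff_radialBump (x : E) (δ : ℝ) : ContDiff ℝ ∞ (radialBump x δ) :=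
  expNegInvGlue.contDiff.comp <|
    contDiff_const.sub (((contDiff_id.sub contDiff_const).norm_sq ℝ).div_const _)

theorem laplacian_radialBump [FiniteDimensional ℝ E] (x : E) (δ : ℝ) (y : E) :
    Δ (radialBump x δ) y =
      -(2 * finrank ℝ E / δ ^ 2 * glueDeriv (1 - ‖y - x‖ ^ 2 / δ ^ 2)) +
        4 * ‖y - x‖ ^ 2 / δ ^ 4 * glueDerivTwo (1 - ‖y - x‖ ^ 2 / δ ^ 2) := by
  have hinner (t : ℝ) : HasDerivAt (fun t => 1 - t / δ ^ 2) (-(1 / δ ^ 2)) t := by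
    simpa using ((hasDerivAt_id t).div_const (δ ^ 2)).const_sub 1
  have hfirst (t : ℝ) : HasDerivAt (fun t => expNegInvGlue (1 - t / δ ^ 2))
      (glueDeriv (1 - t / δ ^ 2) * -(1 / δ ^ 2)) t :=
    (hasDerivAt_expNegInvGlue _).comp t (hinner t)
  have hsecond (t : ℝ) : HasDerivAt (fun t => glueDeriv (1 - t / δ ^ 2) * -(1 / δ ^ 2))
      (glueDerivTwo (1 - t / δ ^ 2) * -(1 / δ ^ 2) * -(1 / δ ^ 2)) t :=
    ((hasDerivAt_glueDeriv _).comp t (hinner t)).mul_const _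
  unfold radialBump
  rw [laplacian_comp_norm_sub_sq hfirst (hsecond _)]
  ring

theorem laplacian_radialBump_of_notMem_ball [FiniteDimensional ℝ E] {x y : E} {δ : ℝ}
    (hδ : 0 < δ) (hy : y ∉ ball x δ) : Δ (radialBump x δ) y = 0 := by
  simp [laplacian_radialBump, glueDeriv_of_nonpos (one_sub_norm_sq_div_nonpos hδ hy),
    glueDerivTwo_of_nonpos (one_sub_norm_sq_div_nonpos hδ hy)]

theorem continuous_laplacian_radialBump [FiniteDimensional ℝ E] (x : E) (δ : ℝ) :
    Continuous (Δ (radialBump x δ)) := by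
  rw [show Δ (radialBump x δ) = _ from funext (laplacian_radialBump x δ)]
  fun_prop

variable (E) in
theorem exists_abs_laplacian_radialBump_le [FiniteDimensional ℝ E] :
    ∃ C : ℝ, 0 < C ∧ ∀ (x : E) (δ : ℝ), 0 < δ → ∀ y, |Δ (radialBump x δ) y| ≤ C / δ ^ 2 := by
  obtain ⟨A, hA, hfirst⟩ :=
    exists_forall_abs_le_of_eq_zero_of_nonpos continuous_glueDeriv (fun _ => glueDeriv_of_nonpos) 1
  obtain ⟨B, hB, hsecond⟩ := exists_forall_abs_le_of_eq_zero_of_nonpos continuous_glueDerivTwo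
    (fun _ => glueDerivTwo_of_nonpos) 1
  refine ⟨2 * finrank ℝ E * A + 4 * B, by positivity, fun x δ hδ y => ?_⟩
  by_cases hy : y ∈ ball x δ
  swap
  · rw [laplacian_radialBump_of_notMem_ball hδ hy, abs_zero]
    positivity
  have hnorm : ‖y - x‖ ^ 2 ≤ δ ^ 2 := by
    rw [mem_ball_iff_norm] at hy
    gcongr
  have ht := one_sub_norm_sq_div_le_one x y δ
  calc |Δ (radialBump x δ) y|
      ≤ 2 * finrank ℝ E / δ ^ 2 * |glueDeriv (1 - ‖y - x‖ ^ 2 / δ ^ 2)| +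
        4 * ‖y - x‖ ^ 2 / δ ^ 4 * |glueDerivTwo (1 - ‖y - x‖ ^ 2 / δ ^ 2)| := by
        rw [laplacian_radialBump]
        refine (abs_add_le _ _).trans_eq ?_
        rw [abs_neg, abs_mul, abs_mul, abs_of_nonneg (by positivity : 0 ≤ _ / δ ^ 2),
          abs_of_nonneg (by positivity : 0 ≤ _ / δ ^ 4)]
    _ ≤ 2 * finrank ℝ E / δ ^ 2 * A + 4 * δ ^ 2 / δ ^ 4 * B := by
        gcongr
        exacts [hfirst _ ht, hsecond _ ht]
    _ = _ := by field_simp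

end RadialBump

section RadialKernel

variable {E : Type*} [NormedAddCommGroup E] [InnerProductSpace ℝ E] [FiniteDimensional ℝ E]
  [MeasurableSpace E] [BorelSpace E]

variable (E) in
/-- The integral of the unnormalised averaging kernel of radius one. -/
noncomputable def kernelMass : ℝ :=
  ∫ z : E, glueDeriv (1 - ‖z‖ ^ 2)

/-- The averaging kernel of radius `δ` centred at `x`, of integral one; its profile is chosen so
that its derivative in `δ` is a nonnegative multiple of the Laplacian of `radialBump x δ`. -/
noncomputable def radialKernel (x : E) (δ : ℝ) (y : E) : ℝ :=
  (kernelMass E * δ ^ finrank ℝ E)⁻¹ * glueDeriv (1 - ‖y - x‖ ^ 2 / δ ^ 2)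

variable (E) in
theorem kernelMass_pos : 0 < kernelMass E := by
  have hcont : Continuous fun z : E => glueDeriv (1 - ‖z‖ ^ 2) := by fun_prop
  refine hcont.integral_pos_of_hasCompactSupport_nonneg_nonzero (x := 0) ?_
    (fun _ => glueDeriv_nonneg _) ?_
  · refine HasCompactSupport.intro (isCompact_closedBall 0 1) fun z hz => glueDeriv_of_nonpos ?_
    rw [mem_closedBall_zero_iff, not_le] at hz
    nlinarith
  · simpa using (glueDeriv_pos one_pos).ne'

theorem radialKernel_nonneg (x : E) {δ : ℝ} (hδ : 0 < δ) (y : E) : 0 ≤ radialKernel x δ y := by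
  have := kernelMass_pos E
  exact mul_nonneg (by positivity) (glueDeriv_nonneg _)

theorem continuous_radialKernel (x : E) (δ : ℝ) : Continuous (radialKernel x δ) := by
  unfold radialKernel
  fun_prop

theorem radialKernel_of_notMem_ball {x y : E} {δ : ℝ} (hδ : 0 < δ) (hy : y ∉ ball x δ) :
    radialKernel x δ y = 0 := by
  rw [radialKernel, glueDeriv_of_nonpos (one_sub_norm_sq_div_nonpos hδ hy), mul_zero]

theorem hasCompactSupport_radialKernel {x : E} {δ : ℝ} (hδ : 0 < δ) :
    HasCompactSupport (radialKernel x δ) :=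
  HasCompactSupport.intro (isCompact_closedBall x δ) fun _ hy =>
    radialKernel_of_notMem_ball hδ fun h => hy (ball_subset_closedBall h)

theorem integral_radialKernel (x : E) {δ : ℝ} (hδ : 0 < δ) : ∫ y, radialKernel x δ y = 1 := by
  have hmass := kernelMass_pos E
  have hscale : ∫ y : E, glueDeriv (1 - ‖y‖ ^ 2 / δ ^ 2) = δ ^ finrank ℝ E * kernelMass E := by
    rw [kernelMass, ← smul_eq_mul, ← Measure.integral_comp_inv_smul_of_nonneg _ _ hδ.le]
    simp [norm_smul, abs_of_pos hδ, mul_pow, div_eq_inv_mul]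
  rw [← integral_add_right_eq_self _ x]
  simp only [radialKernel, add_sub_cancel_right, integral_const_mul, hscale]
  field_simp

variable (E) in
theorem exists_radialKernel_le :
    ∃ C : ℝ, 0 < C ∧ ∀ (x : E) (δ : ℝ), 0 < δ → ∀ y,
      radialKernel x δ y ≤ C / volume.real (closedBall x δ) := by
  have hmass := kernelMass_pos E
  have hball : 0 < volume.real (ball (0 : E) 1) :=
    ENNReal.toReal_pos (measure_ball_pos _ _ one_pos).ne' measure_ball_lt_top.ne
  obtain ⟨M, hM, hle⟩ :=
    exists_forall_abs_le_of_eq_zero_of_nonpos continuous_glueDeriv (fun _ => glueDeriv_of_nonpos) 1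
  refine ⟨M * volume.real (ball (0 : E) 1) / kernelMass E, by positivity, fun x δ hδ y => ?_⟩
  rw [Measure.addHaar_real_closedBall _ _ hδ.le]
  calc radialKernel x δ y ≤ (kernelMass E * δ ^ finrank ℝ E)⁻¹ * M :=
        mul_le_mul_of_nonneg_left ((le_abs_self _).trans (hle _ (one_sub_norm_sq_div_le_one _ _ _)))
          (by positivity)
    _ = _ := by field_simp

variable (E) in
theorem exists_le_radialKernel {c : ℝ} (hc : c ^ 2 < 1) :
    ∃ m : ℝ, 0 < m ∧ ∀ (x : E) (δ : ℝ), 0 < δ → ∀ y ∈ closedBall x (c * δ),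
      m / δ ^ finrank ℝ E ≤ radialKernel x δ y := by
  have hmass := kernelMass_pos E
  obtain ⟨m, hm, hle⟩ := exists_pos_le_glueDeriv (sub_pos.2 hc) 1
  refine ⟨m / kernelMass E, by positivity, fun x δ hδ y hy => ?_⟩
  calc m / kernelMass E / δ ^ finrank ℝ E = (kernelMass E * δ ^ finrank ℝ E)⁻¹ * m := by field_simp
    _ ≤ radialKernel x δ y := mul_le_mul_of_nonneg_left
        (hle _ ⟨one_sub_sq_le_of_mem_closedBall hδ hy, one_sub_norm_sq_div_le_one _ _ _⟩)
        (by positivity)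

theorem hasDerivAt_inv_pow {δ : ℝ} (hδ : δ ≠ 0) (N : ℕ) :
    HasDerivAt (fun d : ℝ => (d ^ N)⁻¹) (-(N * (δ ^ N)⁻¹ / δ)) δ := by
  have h := hasDerivAt_zpow (-N : ℤ) δ (Or.inl hδ)
  simp only [zpow_neg, zpow_natCast] at h
  refine h.congr_deriv ?_
  rw [zpow_sub_one₀ hδ, zpow_neg, zpow_natCast]
  push_cast
  ring

theorem hasDerivAt_radialKernel (x y : E) {δ : ℝ} (hδ : 0 < δ) :
    HasDerivAt (fun d => radialKernel x d y)
      ((kernelMass E * δ ^ finrank ℝ E)⁻¹ * (δ / 2) * Δ (radialBump x δ) y) δ := by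
  have harg : HasDerivAt (fun d : ℝ => 1 - ‖y - x‖ ^ 2 / d ^ 2) (2 * ‖y - x‖ ^ 2 / δ ^ 3) δ := by
    refine (((hasDerivAt_inv_pow hδ.ne' 2).const_mul (‖y - x‖ ^ 2)).const_sub 1).congr_deriv ?_
    field_simp
    norm_num
  have hprod := ((hasDerivAt_inv_pow hδ.ne' (finrank ℝ E)).mul
    ((hasDerivAt_glueDeriv _).comp δ harg)).const_mul (kernelMass E)⁻¹
  have hfun : (fun d => radialKernel x d y) = fun d => (kernelMass E)⁻¹ *
      ((d ^ finrank ℝ E)⁻¹ * glueDeriv (1 - ‖y - x‖ ^ 2 / d ^ 2)) := by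
    funext d
    rw [radialKernel, mul_inv, mul_assoc]
  rw [hfun]
  refine hprod.congr_deriv ?_
  rw [laplacian_radialBump, Function.comp_apply]
  field_simp
  ring

end RadialKernel

section RadialAverage

theorem hasDerivAt_integral_mul_of_locallyIntegrable {X : Type*} [TopologicalSpace X] [T2Space X]
    [SecondCountableTopology X] [MeasurableSpace X] [BorelSpace X] {μ : Measure X} {u : X → ℝ}
    (hu : LocallyIntegrable u μ)
    {K : Set X} (hK : IsCompact K) {k k' : ℝ → X → ℝ} {s : Set ℝ} {δ C : ℝ} (hs : s ∈ 𝓝 δ)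
    (hk : ∀ d ∈ s, Continuous (k d)) (hkδ : HasCompactSupport (k δ)) (hk' : Continuous (k' δ))
    (hderiv : ∀ d ∈ s, ∀ y, HasDerivAt (k · y) (k' d y) d)
    (hbound : ∀ d ∈ s, ∀ y, |k' d y| ≤ K.indicator (fun _ => C) y) :
    HasDerivAt (fun d => ∫ y, u y * k d y ∂μ) (∫ y, u y * k' δ y ∂μ) δ := by
  have hmeas {g : X → ℝ} (hg : Continuous g) : AEStronglyMeasurable (fun y => u y * g y) μ :=
    hu.aestronglyMeasurable.mul hg.aestronglyMeasurable
  refine (hasDerivAt_integral_of_dominated_loc_of_deriv_le (F' := fun d y => u y * k' d y)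
    (bound := K.indicator fun y => |u y| * C) hs ?_ ?_ ?_ ?_ ?_ ?_).2
  · filter_upwards [hs] with d hd using hmeas (hk d hd)
  · exact hu.integrable_smul_right_of_hasCompactSupport (hk δ (mem_of_mem_nhds hs)) hkδ
  · exact hmeas hk'
  · refine Eventually.of_forall fun y d hd => ?_
    calc ‖u y * k' d y‖ = |u y| * |k' d y| := abs_mul _ _
      _ ≤ |u y| * K.indicator (fun _ => C) y := by gcongr; exact hbound d hd y
      _ = _ := (indicator_mul_right K (fun y => |u y|) _).symm
  · rw [integrable_indicator_iff hK.measurableSet]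
    exact (hu.integrableOn_isCompact hK).abs.mul_const C
  · exact Eventually.of_forall fun y d hd => (hderiv d hd y).const_mul (u y)

variable {E : Type*} [NormedAddCommGroup E] [InnerProductSpace ℝ E] [FiniteDimensional ℝ E]
  [MeasurableSpace E] [BorelSpace E] {u : E → ℝ} {x : E}

/-- The weighted average of `u` over the ball of radius `δ` centred at `x`, with the weight
`radialKernel x δ`. -/
noncomputable def radialAverage (u : E → ℝ) (x : E) (δ : ℝ) : ℝ := ∫ y, u y * radialKernel x δ y

theorem ae_tendsto_radialAverage (hu : LocallyIntegrable u volume) :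
    ∀ᵐ x, Tendsto (radialAverage u x) (𝓝[>] 0) (𝓝 (u x)) := by
  obtain ⟨C, -, hC⟩ := exists_radialKernel_le E
  filter_upwards [(Besicovitch.vitaliFamily volume).ae_tendsto_average_norm_sub hu] with x hx
  have hcomm : radialAverage u x = fun d => ∫ y, radialKernel x d y • u y := by
    simp only [funext_iff, radialAverage, mul_comm (u _), smul_eq_mul, implies_true]
  rw [hcomm]
  refine tendsto_integral_smul_of_tendsto_average_norm_sub C
    (hx.comp (Besicovitch.tendsto_filterAt volume x)) ?_ ?_ ?_ ?_
  · exact Eventually.of_forall fun d => hu.integrableOn_isCompact (isCompact_closedBall x d)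
  · refine tendsto_const_nhds.congr' ?_
    filter_upwards [self_mem_nhdsWithin] with d hd using (integral_radialKernel x hd).symm
  · filter_upwards [self_mem_nhdsWithin] with d hd y hy
    by_contra hyd
    exact hy (radialKernel_of_notMem_ball hd fun h => hyd (ball_subset_closedBall h))
  · filter_upwards [self_mem_nhdsWithin] with d hd y
    rw [abs_of_nonneg (radialKernel_nonneg x hd y)]
    exact hC x d hd y

theorem hasDerivAt_radialAverage (hu : LocallyIntegrable u volume) {δ : ℝ} (hδ : 0 < δ) :
    HasDerivAt (radialAverage u x)
      ((kernelMass E * δ ^ finrank ℝ E)⁻¹ * (δ / 2) * ∫ y, u y * Δ (radialBump x δ) y) δ := by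
  obtain ⟨C, hC, hle⟩ := exists_abs_laplacian_radialBump_le E
  have hmass := kernelMass_pos E
  have key := hasDerivAt_integral_mul_of_locallyIntegrable hu (isCompact_closedBall x (2 * δ))
    (Ioo_mem_nhds (half_lt_self hδ) (by linarith : δ < 2 * δ))
    (k' := fun d y => (kernelMass E * d ^ finrank ℝ E)⁻¹ * (d / 2) * Δ (radialBump x d) y)
    (C := (kernelMass E * (δ / 2) ^ finrank ℝ E)⁻¹ * (2 * δ / 2) * (C / (δ / 2) ^ 2))
    (fun d _ => continuous_radialKernel x d) (hasCompactSupport_radialKernel hδ)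
    (continuous_const.mul (continuous_laplacian_radialBump x δ))
    (fun d hd y => hasDerivAt_radialKernel x y (by linarith [hd.1])) fun d hd y => ?_
  · refine key.congr_deriv ?_
    rw [← integral_const_mul]
    exact integral_congr_ae (Eventually.of_forall fun y => mul_left_comm _ _ _)
  have hd0 : 0 < d := by linarith [hd.1]
  by_cases hy : y ∈ closedBall x (2 * δ)
  · rw [indicator_of_mem hy, abs_mul, abs_of_nonneg (by positivity)]
    have h₁ := hd.1.le
    have h₂ := hd.2.le
    have h₃ := hle x d hd0 y
    gcongr
    exact h₃.trans (by gcongr)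
  · rw [indicator_of_notMem hy, laplacian_radialBump_of_notMem_ball hd0 fun h =>
      hy (ball_subset_closedBall (ball_subset_ball hd.2.le h)), mul_zero, abs_zero]

end RadialAverage

section WeightedIntegral

variable {X : Type*} [MeasurableSpace X] {μ : Measure X} {f g : X → ℝ} {s t : Set X}

theorem mul_setIntegral_le_integral_mul {m : ℝ} (hs : MeasurableSet s) (hst : s ⊆ t)
    (hf : IntegrableOn f s μ) (hfg : Integrable (fun y => f y * g y) μ)
    (hpos : ∀ᵐ y ∂μ, y ∈ t → 0 ≤ f y) (hg : ∀ y, 0 ≤ g y) (hgt : ∀ y ∉ t, g y = 0)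
    (hm : ∀ y ∈ s, m ≤ g y) : m * ∫ y in s, f y ∂μ ≤ ∫ y, f y * g y ∂μ := by
  have hnonneg : 0 ≤ᵐ[μ] fun y => f y * g y := by
    filter_upwards [hpos] with y hy
    by_cases hyt : y ∈ t
    · exact mul_nonneg (hy hyt) (hg y)
    · simp [hgt y hyt]
  rw [← integral_const_mul]
  refine le_trans (setIntegral_mono_on_ae (hf.const_mul m) hfg.integrableOn hs ?_)
    (setIntegral_le_integral hfg hnonneg)
  filter_upwards [hpos] with y hy hys
  rw [mul_comm]
  exact mul_le_mul_of_nonneg_left (hm y hys) (hy (hst hys))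

theorem abs_integral_mul_le_mul_setIntegral {M : ℝ} (ht : MeasurableSet t)
    (hf : IntegrableOn f t μ) (hpos : ∀ᵐ y ∂μ, y ∈ t → 0 ≤ f y) (hgt : ∀ y ∉ t, g y = 0)
    (hM : ∀ y, |g y| ≤ M) : |∫ y, f y * g y ∂μ| ≤ M * ∫ y in t, f y ∂μ := by
  have hset : ∫ y in t, f y * g y ∂μ = ∫ y, f y * g y ∂μ :=
    setIntegral_eq_integral_of_forall_compl_eq_zero fun y hy => by rw [hgt y hy, mul_zero]
  rw [← Real.norm_eq_abs, ← hset, ← integral_const_mul]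
  refine norm_integral_le_of_norm_le (hf.const_mul M) ((ae_restrict_iff' ht).2 ?_)
  filter_upwards [hpos] with y hy hyt
  rw [Real.norm_eq_abs, abs_mul, abs_of_nonneg (hy hyt), mul_comm]
  exact mul_le_mul_of_nonneg_right (hM y) (hy hyt)

theorem ae_eq_zero_of_setIntegral_nonpos (hs : MeasurableSet s) (hf : IntegrableOn f s μ)
    (hpos : ∀ᵐ y ∂μ, y ∈ s → 0 ≤ f y) (hint : ∫ y in s, f y ∂μ ≤ 0) :
    ∀ᵐ y ∂μ, y ∈ s → f y = 0 := by
  rw [← ae_restrict_iff' hs] at hpos ⊢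
  exact (integral_eq_zero_iff_of_nonneg_ae hpos hf).1
    (hint.antisymm (integral_nonneg_of_ae hpos))

theorem sq_measureReal_univ_le_integral_mul_integral_inv [IsFiniteMeasure μ]
    (hf : ∀ᵐ y ∂μ, 0 < f y) (hfi : Integrable f μ) (hfi' : Integrable (fun y => (f y)⁻¹) μ) :
    μ.real univ ^ 2 ≤ (∫ y, f y ∂μ) * ∫ y, (f y)⁻¹ ∂μ := by
  have hquad (t : ℝ) :
      0 ≤ (∫ y, f y ∂μ) * (t * t) + (-2 * μ.real univ) * t + ∫ y, (f y)⁻¹ ∂μ := by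
    have hnonneg : 0 ≤ ∫ y, (f y * (t * t) + -2 * t + (f y)⁻¹) ∂μ := by
      refine integral_nonneg_of_ae (hf.mono fun y hy => ?_)
      calc (0 : ℝ) ≤ f y * (t - (f y)⁻¹) ^ 2 := by positivity
        _ = _ := by field_simp; ring
    have hlin : Integrable (fun y => f y * (t * t) + -2 * t) μ :=
      (hfi.mul_const _).add (integrable_const _)
    rw [integral_add hlin hfi', integral_add (hfi.mul_const _) (integrable_const _),
      integral_mul_const, integral_const, smul_eq_mul] at hnonneg
    linarith
  have hdiscrim := discrim_le_zero hquad
  rw [discrim] at hdiscrim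
  linarith

theorem ae_pos_and_integrable_inv_of_lintegral_lt_top (hf : AEMeasurable f μ)
    (hint : ∫⁻ y, 1 / ENNReal.ofReal (f y) ∂μ < ⊤) :
    (∀ᵐ y ∂μ, 0 < f y) ∧ Integrable (fun y => (f y)⁻¹) μ := by
  have hpos : ∀ᵐ y ∂μ, 0 < f y := by
    filter_upwards [ae_lt_top' (hf.ennreal_ofReal.const_div 1) hint.ne] with y hy
    by_contra hneg
    simp [ENNReal.ofReal_of_nonpos (not_lt.1 hneg)] at hy
  refine ⟨hpos, hf.inv.aestronglyMeasurable, ?_⟩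
  rw [hasFiniteIntegral_iff_ofReal (hpos.mono fun y hy => (inv_pos.2 hy).le)]
  refine hint.trans_le' (lintegral_mono_ae (hpos.mono fun y hy => ?_))
  rw [one_div, ENNReal.ofReal_inv_of_pos hy]

theorem integrable_inv_and_integral_inv_le_mul {w : X → ℝ} {M : ℝ} (hfm : AEMeasurable f μ)
    (hf : ∀ᵐ y ∂μ, 0 < f y) (hw : ∀ᵐ y ∂μ, 0 < w y ∧ w y ≤ M)
    (hint : Integrable (fun y => (w y * f y)⁻¹) μ) :
    Integrable (fun y => (f y)⁻¹) μ ∧ ∫ y, (f y)⁻¹ ∂μ ≤ M * ∫ y, (w y * f y)⁻¹ ∂μ := by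
  have hle : ∀ᵐ y ∂μ, (f y)⁻¹ ≤ M * (w y * f y)⁻¹ := by
    filter_upwards [hf, hw] with y hfy ⟨hwy, hwM⟩
    calc (f y)⁻¹ = w y * (w y * f y)⁻¹ := by field_simp
      _ ≤ _ := by gcongr
  have hinv : Integrable (fun y => (f y)⁻¹) μ := by
    refine (hint.const_mul M).mono' hfm.inv.aestronglyMeasurable ?_
    filter_upwards [hf, hle] with y hfy hle
    rwa [Real.norm_of_nonneg (inv_pos.2 hfy).le]
  refine ⟨hinv, ?_⟩
  rw [← integral_const_mul]
  exact integral_mono_ae hinv (hint.const_mul M) hle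

end WeightedIntegral

theorem integrableOn_ball_of_locallyIntegrable {X F : Type*} [PseudoMetricSpace X] [ProperSpace X]
    [MeasurableSpace X] [NormedAddCommGroup F] {μ : Measure X} {f : X → F}
    (hf : LocallyIntegrable f μ) (x : X) (s : ℝ) : IntegrableOn f (ball x s) μ :=
  (hf.integrableOn_isCompact (isCompact_closedBall x s)).mono_set ball_subset_closedBall

section WeakHarnack

variable {E : Type*} [NormedAddCommGroup E] [InnerProductSpace ℝ E] [FiniteDimensional ℝ E]
  [MeasurableSpace E] [BorelSpace E] {u : E → ℝ}

/-- `u` is weakly superharmonic on `s`: `Δ u ≤ 0` on `s` in the sense of distributions. -/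
def IsWeaklySuperharmonicOn (u : E → ℝ) (s : Set E) : Prop :=
  ∀ φ : E → ℝ, ContDiff ℝ ∞ φ → HasCompactSupport φ → tsupport φ ⊆ s → 0 ≤ φ →
    ∫ y, u y * Δ φ y ≤ 0

theorem IsWeaklySuperharmonicOn.mono {s t : Set E} (hu : IsWeaklySuperharmonicOn u t)
    (hst : s ⊆ t) : IsWeaklySuperharmonicOn u s :=
  fun φ hφ hφc hφs => hu φ hφ hφc (hφs.trans hst)

theorem IsWeaklySuperharmonicOn.antitoneOn_radialAverage {x : E} {D : ℝ}
    (hsuper : IsWeaklySuperharmonicOn u (ball x D)) (hu : LocallyIntegrable u volume) :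
    AntitoneOn (radialAverage u x) (Ioo 0 D) := by
  have hd (d) (hd : d ∈ Ioo 0 D) := hasDerivAt_radialAverage (x := x) hu hd.1
  refine antitoneOn_of_hasDerivWithinAt_nonpos (convex_Ioo 0 D)
    (fun d hd' => (hd d hd').continuousAt.continuousWithinAt)
    (fun d hd' => (hd d (interior_subset hd')).hasDerivWithinAt) fun d hd' => ?_
  rw [interior_Ioo] at hd'
  have hmass := kernelMass_pos E
  have h0 : 0 < d := hd'.1
  refine mul_nonpos_of_nonneg_of_nonpos (by positivity)
    (hsuper _ (contDiff_radialBump x d) (hasCompactSupport_radialBump h0) ?_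
      (radialBump_nonneg x d))
  exact (tsupport_radialBump_subset h0).trans (closedBall_subset_ball hd'.2)

theorem ae_radialAverage_le (hu : LocallyIntegrable u volume) :
    ∀ᵐ x, ∀ D, IsWeaklySuperharmonicOn u (ball x D) → ∀ δ ∈ Ioo 0 D, radialAverage u x δ ≤ u x := by
  filter_upwards [ae_tendsto_radialAverage hu] with x hx D hsuper δ hδ
  refine ge_of_tendsto hx ?_
  filter_upwards [Ioo_mem_nhdsGT hδ.1] with d hd
  exact hsuper.antitoneOn_radialAverage hu ⟨hd.1, hd.2.trans hδ.2⟩ hδ hd.2.le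

theorem exists_weak_harnack :
    ∃ c : ℝ, 0 < c ∧ ∀ (u : E → ℝ) (x₀ : E) (s : ℝ), 0 < s → LocallyIntegrable u volume →
      IsWeaklySuperharmonicOn u (ball x₀ (6 * s)) → (∀ᵐ y, y ∈ ball x₀ (6 * s) → 0 ≤ u y) →
      ∀ᵐ x, x ∈ ball x₀ s → c / s ^ finrank ℝ E * ∫ y in ball x₀ (2 * s), u y ≤ u x := by
  obtain ⟨m, hm, hle⟩ := exists_le_radialKernel E (c := 3 / 4) (by norm_num)
  refine ⟨m / 4 ^ finrank ℝ E, by positivity, fun u x₀ s hs hu hsuper hpos => ?_⟩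
  filter_upwards [ae_radialAverage_le hu] with x hx hxs
  rw [mem_ball] at hxs
  have h4s : 0 < 4 * s := by linarith
  have hsub : ball x (5 * s) ⊆ ball x₀ (6 * s) := ball_subset_ball' (by linarith)
  have hsub' : ball x₀ (2 * s) ⊆ closedBall x (3 / 4 * (4 * s)) :=
    (ball_subset_ball' (by rw [dist_comm]; linarith)).trans ball_subset_closedBall
  calc m / 4 ^ finrank ℝ E / s ^ finrank ℝ E * ∫ y in ball x₀ (2 * s), u y
      = m / (4 * s) ^ finrank ℝ E * ∫ y in ball x₀ (2 * s), u y := by rw [div_div, mul_pow]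
    _ ≤ radialAverage u x (4 * s) := by
        refine mul_setIntegral_le_integral_mul measurableSet_ball
          (hsub'.trans (closedBall_subset_ball (by linarith)))
          (integrableOn_ball_of_locallyIntegrable hu x₀ _)
          (hu.integrable_smul_right_of_hasCompactSupport (continuous_radialKernel x _)
            (hasCompactSupport_radialKernel h4s))
          (hpos.mono fun y hy hyx => hy (hsub (ball_subset_ball (by linarith) hyx)))
          (radialKernel_nonneg x h4s) (fun y => radialKernel_of_notMem_ball h4s)
          fun y hy => hle x _ h4s y (hsub' hy)
    _ ≤ u x := hx _ (hsuper.mono hsub) _ ⟨by linarith, by linarith⟩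

end WeakHarnack

theorem tendsto_setIntegral_norm_gt {E F : Type*} [NormedAddCommGroup E] [MeasurableSpace E]
    [OpensMeasurableSpace E] [NormedAddCommGroup F] [NormedSpace ℝ F] {μ : Measure E} {f : E → F}
    {r : ℝ} (hf : IntegrableOn f {x | r < ‖x‖} μ) :
    Tendsto (fun ρ : ℝ => ∫ x in {x | ρ < ‖x‖}, f x ∂μ) atTop (𝓝 0) := by
  have h := tendsto_setIntegral_of_antitone (μ := μ) (f := f)
    (fun ρ : ℝ => measurableSet_lt measurable_const measurable_norm)
    (fun a b hab x (hx : b < ‖x‖) => hab.trans_lt hx) ⟨r, hf⟩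
  have hempty : (⋂ ρ : ℝ, {x : E | ρ < ‖x‖}) = ∅ :=
    iInter_eq_empty_iff.2 fun x => ⟨‖x‖, lt_irrefl ‖x‖⟩
  simpa only [hempty, setIntegral_empty] using h

theorem memLp_restrict_of_memLp_top {X F : Type*} [TopologicalSpace X] [MeasurableSpace X]
    [NormedAddCommGroup F] {μ : Measure X} [IsFiniteMeasureOnCompacts μ] {f : X → F} {K : Set X}
    (hK : IsCompact K) (hf : MemLp f ⊤ (μ.restrict K)) (p : ENNReal) :
    MemLp f p (μ.restrict K) := by
  have : IsFiniteMeasure (μ.restrict K) := ⟨by simpa using hK.measure_lt_top⟩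
  exact hf.mono_exponent le_top

section VanishingNearInfinity

variable {n : ℕ} {V u : EuclideanSpace ℝ (Fin n) → ℝ} {x₀ : EuclideanSpace ℝ (Fin n)} {s : ℝ}

theorem IsLinftyLoc.locallyIntegrable (hV : IsLinftyLoc V) : LocallyIntegrable V volume :=
  locallyIntegrable_iff.2 fun K hK =>
    memLp_one_iff_integrable.1 (memLp_restrict_of_memLp_top hK (hV.2 K hK) 1)

theorem IsWeakSolution.isWeaklySuperharmonicOn {s : Set (EuclideanSpace ℝ (Fin n))}
    (hu : IsWeakSolution V u) (hpos : ∀ᵐ y, y ∈ s → 0 ≤ V y * u y) :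
    IsWeaklySuperharmonicOn u s := by
  intro φ hφ hφc hφs hφ0
  rw [← neg_nonneg, hu.weak_eq φ hφ hφc]
  refine integral_nonneg_of_ae ?_
  filter_upwards [hpos] with y hy
  by_cases hys : y ∈ s
  · exact mul_nonneg (hy hys) (hφ0 y)
  · simp [image_eq_zero_of_notMem_tsupport fun h => hys (hφs h)]

theorem exists_setIntegral_potential_mul_le (n : ℕ) : ∃ C : ℝ, 0 < C ∧
    ∀ (V u : EuclideanSpace ℝ (Fin n) → ℝ) (x₀ : EuclideanSpace ℝ (Fin n)) (s : ℝ), 0 < s →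
    IsWeakSolution V u → (∀ᵐ y, y ∈ ball x₀ (2 * s) → 0 ≤ u y ∧ 0 ≤ V y * u y) →
    ∫ y in ball x₀ s, V y * u y ≤ C / s ^ 2 * ∫ y in ball x₀ (2 * s), u y := by
  obtain ⟨C, hC, hle⟩ := exists_abs_laplacian_radialBump_le (EuclideanSpace ℝ (Fin n))
  have he : 0 < expNegInvGlue (3 / 4) := expNegInvGlue.pos_of_pos (by norm_num)
  refine ⟨C / 4 / expNegInvGlue (3 / 4), by positivity, fun V u x₀ s hs hu hpos => ?_⟩
  have h2s : 0 < 2 * s := by linarith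
  have hbump := contDiff_radialBump x₀ (2 * s)
  have hsupp := hasCompactSupport_radialBump (x := x₀) h2s
  have hlower : expNegInvGlue (3 / 4) * ∫ y in ball x₀ s, V y * u y ≤
      ∫ y, V y * u y * radialBump x₀ (2 * s) y := by
    refine mul_setIntegral_le_integral_mul measurableSet_ball (ball_subset_ball (by linarith))
      (integrableOn_ball_of_locallyIntegrable hu.locallyIntegrable_mul x₀ s)
      (hu.locallyIntegrable_mul.integrable_smul_right_of_hasCompactSupport hbump.continuous hsupp)
      (hpos.mono fun y hy hys => (hy hys).2) (radialBump_nonneg x₀ _)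
      (fun y => radialBump_of_notMem_ball h2s) fun y hy => expNegInvGlue.monotone ?_
    have := one_sub_sq_le_of_mem_closedBall (c := 1 / 2) h2s
      (by simpa using ball_subset_closedBall hy)
    linarith
  have hupper : -∫ y, u y * Δ (radialBump x₀ (2 * s)) y ≤
      C / (2 * s) ^ 2 * ∫ y in ball x₀ (2 * s), u y :=
    (neg_le_abs _).trans <| abs_integral_mul_le_mul_setIntegral measurableSet_ball
      (integrableOn_ball_of_locallyIntegrable hu.locallyIntegrable x₀ _)
      (hpos.mono fun y hy hys => (hy hys).1)
      (fun y => laplacian_radialBump_of_notMem_ball h2s) (hle x₀ _ h2s)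
  rw [← hu.weak_eq _ hbump hsupp] at hlower
  calc _ ≤ C / (2 * s) ^ 2 * (∫ y in ball x₀ (2 * s), u y) / expNegInvGlue (3 / 4) :=
        (le_div_iff₀' he).2 (hlower.trans hupper)
    _ = _ := by field_simp; norm_num; ring

theorem exists_setIntegral_potential_le (n : ℕ) : ∃ C : ℝ, 0 < C ∧
    ∀ (V u : EuclideanSpace ℝ (Fin n) → ℝ) (x₀ : EuclideanSpace ℝ (Fin n)) (s : ℝ), 0 < s →
    LocallyIntegrable V volume → IsWeakSolution V u →
    (∀ᵐ y, y ∈ ball x₀ (6 * s) → 0 ≤ u y ∧ 0 ≤ V y) → 0 < ∫ y in ball x₀ (2 * s), u y →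
    ∫ y in ball x₀ s, V y ≤ C * s ^ n / s ^ 2 := by
  obtain ⟨c, hc, hharnack⟩ := exists_weak_harnack (E := EuclideanSpace ℝ (Fin n))
  obtain ⟨C, hC, hmul⟩ := exists_setIntegral_potential_mul_le n
  refine ⟨C / c, by positivity, fun V u x₀ s hs hV hu hpos hI => ?_⟩
  have hVu : ∀ᵐ y, y ∈ ball x₀ (6 * s) → 0 ≤ V y * u y :=
    hpos.mono fun y hy hys => mul_nonneg (hy hys).2 (hy hys).1
  have hinf := hharnack u x₀ s hs hu.locallyIntegrable (hu.isWeaklySuperharmonicOn hVu)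
    (hpos.mono fun y hy hys => (hy hys).1)
  rw [finrank_euclideanSpace_fin] at hinf
  have hs6 : ball x₀ s ⊆ ball x₀ (6 * s) := ball_subset_ball (by linarith)
  have hs26 : ball x₀ (2 * s) ⊆ ball x₀ (6 * s) := ball_subset_ball (by linarith)
  set I := ∫ y in ball x₀ (2 * s), u y
  have hle : c / s ^ n * I * ∫ y in ball x₀ s, V y ≤ C / s ^ 2 * I := by
    refine le_trans ?_ (hmul V u x₀ s hs hu ?_)
    · rw [← integral_const_mul]
      refine setIntegral_mono_on_ae
        ((integrableOn_ball_of_locallyIntegrable hV x₀ s).const_mul _)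
        (integrableOn_ball_of_locallyIntegrable hu.locallyIntegrable_mul x₀ s)
        measurableSet_ball ?_
      filter_upwards [hpos, hinf] with y hy hinf hys
      rw [mul_comm]
      exact mul_le_mul_of_nonneg_left (hinf hys) (hy (hs6 hys)).2
    · filter_upwards [hpos, hVu] with y hy hVuy hys using ⟨(hy (hs26 hys)).1, hVuy (hs26 hys)⟩
  calc ∫ y in ball x₀ s, V y ≤ C / s ^ 2 * I / (c / s ^ n * I) :=
        (le_div_iff₀' (by positivity)).2 hle
    _ = _ := by field_simp

theorem exists_le_setIntegral_inv_potential (n : ℕ) : ∃ ε : ℝ, 0 < ε ∧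
    ∀ (V u : EuclideanSpace ℝ (Fin n) → ℝ) (x₀ : EuclideanSpace ℝ (Fin n)) (s : ℝ), 0 < s →
    ‖x₀‖ = 7 * s → LocallyIntegrable V volume → IsWeakSolution V u →
    (∀ᵐ y, y ∈ ball x₀ (6 * s) → 0 ≤ u y ∧ 0 < V y) →
    IntegrableOn (fun y => (‖y‖ ^ (n + 2) * V y)⁻¹) (ball x₀ s) →
    0 < ∫ y in ball x₀ (2 * s), u y →
    ε ≤ ∫ y in ball x₀ s, (‖y‖ ^ (n + 2) * V y)⁻¹ := by
  obtain ⟨C, hC, hpot⟩ := exists_setIntegral_potential_le n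
  have hb : 0 < volume.real (ball (0 : EuclideanSpace ℝ (Fin n)) 1) :=
    ENNReal.toReal_pos (measure_ball_pos _ _ one_pos).ne' measure_ball_lt_top.ne
  set b := volume.real (ball (0 : EuclideanSpace ℝ (Fin n)) 1)
  refine ⟨b ^ 2 / (C * 8 ^ (n + 2)), by positivity, fun V u x₀ s hs hx₀ hV hu hpos hW hI => ?_⟩
  have hVint : IntegrableOn V (ball x₀ s) := integrableOn_ball_of_locallyIntegrable hV x₀ s
  have hVpos : ∀ᵐ y ∂volume.restrict (ball x₀ s), 0 < V y :=
    (ae_restrict_iff' measurableSet_ball).2 <| hpos.mono fun y hy hys =>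
      (hy (ball_subset_ball (by linarith) hys)).2
  have hnorm : ∀ᵐ y ∂volume.restrict (ball x₀ s),
      0 < ‖y‖ ^ (n + 2) ∧ ‖y‖ ^ (n + 2) ≤ (8 * s) ^ (n + 2) := by
    filter_upwards [ae_restrict_mem measurableSet_ball] with y hys
    rw [mem_ball, dist_eq_norm] at hys
    have hlow : 0 < ‖y‖ := by linarith [norm_sub_norm_le x₀ y, norm_sub_rev x₀ y]
    have hup : ‖y‖ ≤ 8 * s := by linarith [norm_sub_norm_le y x₀]
    exact ⟨by positivity, by gcongr⟩
  obtain ⟨hinv, hinvle⟩ := integrable_inv_and_integral_inv_le_mul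
    hVint.aestronglyMeasurable.aemeasurable hVpos hnorm hW
  set J := ∫ y in ball x₀ s, (‖y‖ ^ (n + 2) * V y)⁻¹
  have : IsFiniteMeasure (volume.restrict (ball x₀ s)) := ⟨by simpa using measure_ball_lt_top⟩
  have hCS := sq_measureReal_univ_le_integral_mul_integral_inv hVpos hVint hinv
  have hvol : volume.real (ball x₀ s) = s ^ n * b := by
    simp [b, measureReal_def, Measure.addHaar_ball_of_pos _ _ hs, hs.le]
  rw [measureReal_restrict_apply_univ, hvol] at hCS
  have hbound := calc (s ^ n * b) ^ 2
      ≤ (∫ y in ball x₀ s, V y) * ∫ y in ball x₀ s, (V y)⁻¹ := hCS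
    _ ≤ C * s ^ n / s ^ 2 * ((8 * s) ^ (n + 2) * J) :=
        mul_le_mul (hpot V u x₀ s hs hV hu (hpos.mono fun y hy hys => (hy hys).imp_right le_of_lt)
          hI) hinvle (integral_nonneg_of_ae (hVpos.mono fun y hy => (inv_pos.2 hy).le))
          (by positivity)
    _ = C * 8 ^ (n + 2) * J * (s ^ n) ^ 2 := by rw [mul_pow, pow_add s]; field_simp
  rw [mul_pow, mul_comm] at hbound
  exact (div_le_iff₀' (by positivity)).2 (le_of_mul_le_mul_right hbound (by positivity))

theorem ae_pos_and_integrableOn_inv_potential {r : ℝ} (hV : AEStronglyMeasurable V volume)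
    (hV_inv : (∫⁻ x in {x : EuclideanSpace ℝ (Fin n) | r < ‖x‖},
      1 / ENNReal.ofReal (‖x‖ ^ (n + 2) * V x)) < ⊤) :
    (∀ᵐ x, r < ‖x‖ → 0 < V x) ∧
      IntegrableOn (fun x => (‖x‖ ^ (n + 2) * V x)⁻¹) {x | r < ‖x‖} := by
  have hmeas : AEMeasurable (fun x => ‖x‖ ^ (n + 2) * V x)
      (volume.restrict {x | r < ‖x‖}) :=
    ((by fun_prop : Measurable fun x : EuclideanSpace ℝ (Fin n) => ‖x‖ ^ (n + 2)).aemeasurable.mul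
      hV.aemeasurable).restrict
  obtain ⟨hpos, hint⟩ := ae_pos_and_integrable_inv_of_lintegral_lt_top hmeas hV_inv
  rw [ae_restrict_iff' (measurableSet_lt measurable_const measurable_norm)] at hpos
  exact ⟨hpos.mono fun x hx hxr => pos_of_mul_pos_right (hx hxr) (by positivity), hint⟩

theorem IsWeakSolution.eventually_ae_eq_zero_of_nonnegNearInfinity {r : ℝ} (hV : IsLinftyLoc V)
    (hV_inv : (∫⁻ x in {x : EuclideanSpace ℝ (Fin n) | r < ‖x‖},
      1 / ENNReal.ofReal (‖x‖ ^ (n + 2) * V x)) < ⊤)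
    (hu : IsWeakSolution V u) (hpos : NonnegNearInfinity u) :
    ∀ᶠ s in atTop, ∀ x₀ : EuclideanSpace ℝ (Fin n), ‖x₀‖ = 7 * s →
      ∀ᵐ y, y ∈ ball x₀ (2 * s) → u y = 0 := by
  obtain ⟨R, hR⟩ := hpos
  obtain ⟨hVpos, hW⟩ := ae_pos_and_integrableOn_inv_potential hV.1 hV_inv
  obtain ⟨ε, hε, hlower⟩ := exists_le_setIntegral_inv_potential n
  filter_upwards [eventually_gt_atTop 0, eventually_ge_atTop r, eventually_ge_atTop R,
    (tendsto_setIntegral_norm_gt hW).eventually_lt_const hε] with s hs hrs hRs htail x₀ hx₀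
  have hout (y) (hy : y ∈ ball x₀ (6 * s)) : s < ‖y‖ := by
    rw [mem_ball, dist_eq_norm] at hy
    linarith [norm_sub_norm_le x₀ y, norm_sub_rev x₀ y]
  have hext : ∀ᵐ y, y ∈ ball x₀ (6 * s) → 0 ≤ u y ∧ 0 < V y := by
    filter_upwards [hR, hVpos] with y huy hVy hys
    exact ⟨huy (hRs.trans_lt (hout y hys)), hVy (hrs.trans_lt (hout y hys))⟩
  have hsub : ball x₀ s ⊆ {y | s < ‖y‖} :=
    fun y hy => hout y (ball_subset_ball (by linarith) hy)
  have hWs : IntegrableOn (fun y => (‖y‖ ^ (n + 2) * V y)⁻¹) {y | s < ‖y‖} :=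
    hW.mono_set fun y hy => hrs.trans_lt hy
  have hWpos : 0 ≤ᵐ[volume.restrict {y | s < ‖y‖}] fun y => (‖y‖ ^ (n + 2) * V y)⁻¹ := by
    rw [EventuallyLE, ae_restrict_iff' (measurableSet_lt measurable_const measurable_norm)]
    filter_upwards [hVpos] with y hy hys
    have := hy (hrs.trans_lt hys)
    simp only [Pi.zero_apply]
    positivity
  have hzero : ¬ 0 < ∫ y in ball x₀ (2 * s), u y := fun hI =>
    (hlower V u x₀ s hs hx₀ hV.locallyIntegrable hu hext (hWs.mono_set hsub) hI).not_gt <|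
      (setIntegral_mono_set hWs hWpos hsub.eventuallyLE).trans_lt htail
  exact ae_eq_zero_of_setIntegral_nonpos measurableSet_ball
    (integrableOn_ball_of_locallyIntegrable hu.locallyIntegrable x₀ _)
    (hext.mono fun y hy hys => (hy (ball_subset_ball (by linarith) hys)).1) (not_lt.1 hzero)

theorem IsWeakSolution.exists_ae_eq_zero_of_nonnegNearInfinity {r : ℝ} (hV : IsLinftyLoc V)
    (hV_inv : (∫⁻ x in {x : EuclideanSpace ℝ (Fin n) | r < ‖x‖},
      1 / ENNReal.ofReal (‖x‖ ^ (n + 2) * V x)) < ⊤)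
    (hu : IsWeakSolution V u) (hpos : NonnegNearInfinity u) :
    ∃ R : ℝ, ∀ᵐ x, R < ‖x‖ → u x = 0 := by
  obtain ⟨s₀, hs₀⟩ :=
    eventually_atTop.1 (hu.eventually_ae_eq_zero_of_nonnegNearInfinity hV hV_inv hpos)
  refine ⟨7 * max s₀ 0, ?_⟩
  have hnull : volume {x : EuclideanSpace ℝ (Fin n) | 7 * max s₀ 0 < ‖x‖ ∧ u x ≠ 0} = 0 := by
    refine measure_null_of_locally_null _ fun x₀ hx₀ => ?_
    have hs : max s₀ 0 < ‖x₀‖ / 7 := (lt_div_iff₀' (by norm_num)).2 hx₀.1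
    have hs0 : 0 < ‖x₀‖ / 7 := (le_max_right _ _).trans_lt hs
    refine ⟨_, inter_mem_nhdsWithin _ (ball_mem_nhds x₀ (by linarith : 0 < 2 * (‖x₀‖ / 7))), ?_⟩
    refine measure_mono_null (fun y hy => ?_)
      (ae_iff.1 (hs₀ _ ((le_max_left _ _).trans hs.le) x₀ (by ring)))
    exact fun h => hy.1.2 (h hy.2)
  rw [ae_iff]
  simpa only [Classical.not_imp] using hnull

end VanishingNearInfinity

section Plancherel

open FourierTransform

variable {E F : Type*} [NormedAddCommGroup E] [InnerProductSpace ℝ E] [FiniteDimensional ℝ E]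
  [MeasurableSpace E] [BorelSpace E] [NormedAddCommGroup F] [InnerProductSpace ℂ F]
  [CompleteSpace F] {f : E → F}

theorem ae_eq_fourier_toLp (hf₁ : Integrable f) (hf₂ : MemLp f 2) :
    (𝓕 (hf₂.toLp f) : Lp F 2 volume) =ᵐ[volume] 𝓕 f := by
  have hcont : Continuous (𝓕 f) :=
    VectorFourier.fourierIntegral_continuous Real.continuous_fourierChar continuous_inner hf₁
  refine ae_eq_of_integral_contDiff_smul_eq
    ((Lp.memLp _).locallyIntegrable one_le_two) hcont.locallyIntegrable fun g hg hgc => ?_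
  set G : SchwartzMap E ℂ := (hgc.comp_left Complex.ofReal_zero).toSchwartzMap
    (Complex.ofRealCLM.contDiff.comp hg)
  have hG (h : E → F) : ∫ x, g x • h x = ∫ x, G x • h x :=
    integral_congr_ae (Eventually.of_forall fun x => (Complex.coe_smul (g x) (h x)).symm)
  have hdual : ∫ x, 𝓕 G x • (hf₂.toLp f) x = ∫ x, G x • (𝓕 (hf₂.toLp f) : Lp F 2 volume) x := by
    simpa only [← Lp.fourier_toTemperedDistribution_eq, TemperedDistribution.fourier_apply,
      Lp.toTemperedDistribution_apply] using Lp.toTemperedDistribution_apply (𝓕 (hf₂.toLp f)) G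
  calc ∫ x, g x • (𝓕 (hf₂.toLp f) : Lp F 2 volume) x
      = ∫ x, 𝓕 G x • (hf₂.toLp f) x := by rw [hG, hdual]
    _ = ∫ x, 𝓕 (G : E → ℂ) x • f x := by
        refine integral_congr_ae (hf₂.coeFn_toLp.mono fun x hx => ?_)
        simp only [hx, SchwartzMap.fourier_coe]
    _ = ∫ x, G x • 𝓕 f x := by
        simpa only [flip_innerₗ] using! VectorFourier.integral_fourierIntegral_smul_eq_flip
          (L := innerₗ E) Real.continuous_fourierChar continuous_inner G.integrable hf₁
    _ = ∫ x, g x • 𝓕 f x := (hG _).symm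

theorem eLpNorm_fourier_eq (hf₁ : Integrable f) (hf₂ : MemLp f 2) :
    eLpNorm (𝓕 f) 2 volume = eLpNorm f 2 volume := by
  rw [← eLpNorm_congr_ae (ae_eq_fourier_toLp hf₁ hf₂), ← eLpNorm_congr_ae hf₂.coeFn_toLp,
    ← ENNReal.toReal_eq_toReal_iff' (Lp.memLp _).2.ne (Lp.memLp _).2.ne]
  exact Lp.norm_fourier_eq (hf₂.toLp f)

end Plancherel

section TranslationDifference

open FourierTransform

theorem eLpNorm_le_eLpNorm_translate_sub {E F : Type*} [NormedAddCommGroup E] [MeasurableSpace E]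
    [MeasurableAdd E] [NormedAddCommGroup F] {μ : Measure E} [μ.IsAddRightInvariant] {f : E → F}
    {R : ℝ} (hf : ∀ᵐ x ∂μ, R < ‖x‖ → f x = 0) {a : E} (ha : 2 * R < ‖a‖) (p : ENNReal) :
    eLpNorm f p μ ≤ eLpNorm (fun x => f (x + a) - f x) p μ := by
  refine eLpNorm_mono_ae ?_
  filter_upwards [hf, (measurePreserving_add_right μ a).quasiMeasurePreserving.ae hf] with x hx hxa
  rcases lt_or_ge R ‖x‖ with hlt | hle
  · simp [hx hlt]
  · have htranslate := norm_sub_le (x + a) x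
    rw [add_sub_cancel_left] at htranslate
    simp [hxa (by linarith)]

variable {E F : Type*} [NormedAddCommGroup E] [InnerProductSpace ℝ E] [FiniteDimensional ℝ E]
  [MeasurableSpace E] [BorelSpace E] [NormedAddCommGroup F]

theorem norm_fourier_translate_sub_le [NormedSpace ℂ F] {f : E → F} (hf : Integrable f) (a ξ : E) :
    ‖𝓕 (fun x => f (x + a) - f x) ξ‖ ≤ 2 * Real.pi * |inner ℝ a ξ| * ‖𝓕 f ξ‖ := by
  have htranslate : 𝓕 (fun x => f (x + a)) ξ = Real.fourierChar (inner ℝ a ξ) • 𝓕 f ξ :=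
    congrFun (VectorFourier.fourierIntegral_comp_add_right Real.fourierChar volume
      (innerₗ E) f a) ξ
  have hsub : 𝓕 (fun x => f (x + a) - f x) ξ = 𝓕 (fun x => f (x + a)) ξ - 𝓕 f ξ := by
    simp only [Real.fourier_eq, smul_sub]
    exact integral_sub ((Real.fourierIntegral_convergent_iff ξ).2 (hf.comp_add_right a))
      ((Real.fourierIntegral_convergent_iff ξ).2 hf)
  rw [hsub, htranslate, Circle.smul_def, ← one_smul ℂ (𝓕 f ξ), smul_smul, ← sub_smul, mul_one,
    norm_smul, one_smul]
  refine mul_le_mul_of_nonneg_right ?_ (norm_nonneg _)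
  rw [Real.fourierChar_apply, mul_comm _ Complex.I]
  refine Real.norm_exp_I_mul_ofReal_sub_one_le.trans_eq ?_
  rw [Real.norm_eq_abs, abs_mul, abs_of_pos Real.two_pi_pos]

/-- If `f` lives on a ball of diameter less than `‖a‖`, then `f` and its translate by `a` have
disjoint supports, so that the Fourier multiplier `⟪a, ξ⟫` is bounded below on `f`. -/
theorem eLpNorm_two_le_of_abs_inner_mul_norm_fourier_le [InnerProductSpace ℂ F] [CompleteSpace F]
    {f g : E → F} (hf₁ : Integrable f) (hf₂ : MemLp f 2) (hg₁ : Integrable g) (hg₂ : MemLp g 2)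
    {R : ℝ} (hf : ∀ᵐ x, R < ‖x‖ → f x = 0) {a : E} (ha : 2 * R < ‖a‖) {C : ℝ} (hC : 0 < C)
    (hfg : ∀ ξ, C * |inner ℝ a ξ| * ‖𝓕 f ξ‖ ≤ ‖𝓕 g ξ‖) :
    eLpNorm f 2 volume ≤ ENNReal.ofReal (2 * Real.pi / C) * eLpNorm g 2 volume := by
  set w : E → F := fun x => f (x + a) - f x
  have hw₁ : Integrable w := (hf₁.comp_add_right a).sub hf₁
  have hw₂ : MemLp w 2 :=
    (hf₂.comp_measurePreserving (measurePreserving_add_right volume a)).sub hf₂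
  have hwg (ξ : E) : ‖𝓕 w ξ‖ ≤ 2 * Real.pi / C * ‖𝓕 g ξ‖ :=
    calc ‖𝓕 w ξ‖ ≤ 2 * Real.pi * |inner ℝ a ξ| * ‖𝓕 f ξ‖ := norm_fourier_translate_sub_le hf₁ a ξ
      _ = 2 * Real.pi / C * (C * |inner ℝ a ξ| * ‖𝓕 f ξ‖) := by field_simp
      _ ≤ _ := by gcongr; exact hfg ξ
  calc eLpNorm f 2 volume ≤ eLpNorm w 2 volume := eLpNorm_le_eLpNorm_translate_sub hf ha 2
    _ = eLpNorm (𝓕 w) 2 volume := (eLpNorm_fourier_eq hw₁ hw₂).symm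
    _ ≤ ENNReal.ofReal (2 * Real.pi / C) * eLpNorm (𝓕 g) 2 volume :=
        eLpNorm_le_mul_eLpNorm_of_ae_le_mul (Eventually.of_forall hwg) 2
    _ = _ := by rw [eLpNorm_fourier_eq hg₁ hg₂]

end TranslationDifference

section CompactlySupported

variable {E : Type*} [NormedAddCommGroup E] [ProperSpace E] [MeasurableSpace E] [BorelSpace E]
  {μ : Measure E} {f : E → ℝ} {g : E → ℂ} {R : ℝ}

theorem memLp_ofReal_mul_of_ae_eq_zero {p : ENNReal}
    (hf : MemLp f p (μ.restrict (closedBall 0 R))) (hR : ∀ᵐ x ∂μ, R < ‖x‖ → f x = 0)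
    (hg : Continuous g) : MemLp (fun x => (f x : ℂ) * g x) p μ := by
  obtain ⟨C, hC⟩ := (isCompact_closedBall (0 : E) R).exists_bound_of_continuousOn hg.continuousOn
  have hball : MemLp (fun x => (f x : ℂ) * g x) p (μ.restrict (closedBall 0 R)) := by
    refine hf.of_le_mul (c := C) ((Complex.continuous_ofReal.comp_aestronglyMeasurable hf.1).mul
      hg.aestronglyMeasurable) ?_
    filter_upwards [ae_restrict_mem measurableSet_closedBall] with x hx
    rw [norm_mul, Complex.norm_real, mul_comm]
    gcongr
    exact hC x hx
  rw [← memLp_indicator_iff_restrict measurableSet_closedBall] at hball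
  refine (memLp_congr_ae ?_).1 hball
  filter_upwards [hR] with x hx
  by_cases hxR : x ∈ closedBall 0 R
  · rw [indicator_of_mem hxR]
  · rw [indicator_of_notMem hxR, hx (by simpa using hxR), Complex.ofReal_zero, zero_mul]

theorem integrable_ofReal_mul_of_ae_eq_zero
    (hf : LocallyIntegrable f μ) (hR : ∀ᵐ x ∂μ, R < ‖x‖ → f x = 0) (hg : Continuous g) :
    Integrable (fun x => (f x : ℂ) * g x) μ :=
  memLp_one_iff_integrable.1 <| memLp_ofReal_mul_of_ae_eq_zero
    (memLp_one_iff_integrable.2 (hf.integrableOn_isCompact (isCompact_closedBall 0 R))) hR hg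

end CompactlySupported

section ExponentialWeight

open FourierTransform

variable {E : Type*} [NormedAddCommGroup E] [InnerProductSpace ℝ E]

/-- The function `f` multiplied by the Carleman weight `x ↦ exp ⟪a, x⟫`. It takes complex values
because its Fourier transform is needed. -/
noncomputable def expWeighted (a : E) (f : E → ℝ) (x : E) : ℂ :=
  f x * Complex.exp ((inner ℝ a x : ℝ) : ℂ)

/-- The exponent `x ↦ ⟪a, x⟫ - 2πi ⟪ξ, x⟫` of the exponential whose integral against `f` is the
Fourier transform at `ξ` of `expWeighted a f`. -/
noncomputable def fourierLaplaceExponent (a ξ : E) : E →L[ℝ] ℂ :=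
  Complex.ofRealCLM ∘L innerSL ℝ a -
    (2 * Real.pi * Complex.I : ℂ) • (Complex.ofRealCLM ∘L innerSL ℝ ξ)

theorem fourierLaplaceExponent_apply (a ξ x : E) : fourierLaplaceExponent a ξ x =
    ((inner ℝ a x : ℝ) : ℂ) - 2 * Real.pi * Complex.I * ((inner ℝ ξ x : ℝ) : ℂ) := rfl

theorem im_sum_sq_fourierLaplaceExponent {ι : Type*} [Fintype ι] (b : OrthonormalBasis ι ℝ E)
    (a ξ : E) :
    (∑ i, fourierLaplaceExponent a ξ (b i) ^ 2).im = -(4 * Real.pi * inner ℝ a ξ) := by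
  have hsq (i : ι) : (fourierLaplaceExponent a ξ (b i) ^ 2).im =
      -(4 * Real.pi) * (inner ℝ a (b i) * inner ℝ (b i) ξ) := by
    have hre : (fourierLaplaceExponent a ξ (b i)).re = inner ℝ a (b i) := by
      simp [fourierLaplaceExponent_apply]
    have him : (fourierLaplaceExponent a ξ (b i)).im = -(2 * Real.pi * inner ℝ (b i) ξ) := by
      simp [fourierLaplaceExponent_apply, real_inner_comm ξ]
    rw [pow_two, Complex.mul_im, hre, him]
    ring
  rw [Complex.im_sum, Finset.sum_congr rfl fun i _ => hsq i, ← Finset.mul_sum,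
    b.sum_inner_mul_inner, neg_mul]

theorem fourier_expWeighted [FiniteDimensional ℝ E] [MeasurableSpace E] [BorelSpace E]
    (f : E → ℝ) (a ξ : E) :
    𝓕 (expWeighted a f) ξ = ∫ x, (f x : ℂ) * Complex.exp (fourierLaplaceExponent a ξ x) := by
  rw [Real.fourier_eq']
  refine integral_congr_ae (Eventually.of_forall fun x => ?_)
  simp only [expWeighted, fourierLaplaceExponent_apply, smul_eq_mul]
  rw [mul_left_comm, ← Complex.exp_add, real_inner_comm ξ x]
  congr 2
  push_cast
  ring

theorem norm_expWeighted (a : E) (f : E → ℝ) (x : E) :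
    ‖expWeighted a f x‖ = |f x| * Real.exp (inner ℝ a x) := by
  rw [expWeighted, norm_mul, Complex.norm_real, Complex.norm_exp_ofReal, Real.norm_eq_abs]

variable [ProperSpace E] [MeasurableSpace E] [BorelSpace E] {μ : Measure E} {f : E → ℝ} {R : ℝ}

theorem memLp_expWeighted {p : ENNReal} (a : E) (hf : MemLp f p (μ.restrict (closedBall 0 R)))
    (hR : ∀ᵐ x ∂μ, R < ‖x‖ → f x = 0) : MemLp (expWeighted a f) p μ :=
  memLp_ofReal_mul_of_ae_eq_zero hf hR (by fun_prop)

theorem integrable_expWeighted (a : E) (hf : LocallyIntegrable f μ)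
    (hR : ∀ᵐ x ∂μ, R < ‖x‖ → f x = 0) : Integrable (expWeighted a f) μ :=
  integrable_ofReal_mul_of_ae_eq_zero hf hR (by fun_prop)

end ExponentialWeight

section UniqueContinuation

open FourierTransform

theorem exists_pos_ae_norm_le_of_memLp_top {X F : Type*} [MeasurableSpace X]
    [NormedAddCommGroup F] {μ : Measure X} {f : X → F} (hf : MemLp f ⊤ μ) :
    ∃ M > 0, ∀ᵐ x ∂μ, ‖f x‖ ≤ M := by
  have hfin : eLpNormEssSup f μ ≠ ⊤ := by simpa only [eLpNorm_exponent_top] using hf.2.ne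
  refine ⟨(eLpNormEssSup f μ).toReal + 1, by positivity, ?_⟩
  filter_upwards [ae_le_eLpNormEssSup (f := f) (μ := μ)] with x hx
  have hle := ENNReal.toReal_mono hfin hx
  rw [toReal_enorm] at hle
  linarith

variable {n : ℕ} {V u : EuclideanSpace ℝ (Fin n) → ℝ} {R : ℝ}

theorem IsWeakSolution.weak_eq_of_contDiff (hu : IsWeakSolution V u)
    (hR : ∀ᵐ x, R < ‖x‖ → u x = 0) {ψ : EuclideanSpace ℝ (Fin n) → ℝ} (hψ : ContDiff ℝ ∞ ψ) :
    -∫ x, u x * Δ ψ x = ∫ x, V x * u x * ψ x := by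
  let χ : ContDiffBump (0 : EuclideanSpace ℝ (Fin n)) :=
    ⟨|R| + 1, |R| + 2, by positivity, by linarith⟩
  have hχ (x) (hx : ‖x‖ ≤ R) : (fun x => χ x * ψ x) =ᶠ[𝓝 x] ψ := by
    have hxR : ‖x‖ < |R| + 1 := by linarith [le_abs_self R]
    filter_upwards [isOpen_ball.mem_nhds (mem_ball_zero_iff.2 hxR)] with y hy
    rw [χ.one_of_mem_closedBall (ball_subset_closedBall hy), one_mul]
  have hΔ : ∫ x, u x * Δ (fun x => χ x * ψ x) x = ∫ x, u x * Δ ψ x := by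
    refine integral_congr_ae (hR.mono fun x hx => ?_)
    rcases lt_or_ge R ‖x‖ with hlt | hle
    · simp [hx hlt]
    · exact congrArg (u x * ·) (InnerProductSpace.laplacian_congr_nhds (hχ x hle)).eq_of_nhds
  have hV : ∫ x, V x * u x * (χ x * ψ x) = ∫ x, V x * u x * ψ x := by
    refine integral_congr_ae (hR.mono fun x hx => ?_)
    rcases lt_or_ge R ‖x‖ with hlt | hle
    · simp [hx hlt]
    · exact congrArg (V x * u x * ·) (hχ x hle).eq_of_nhds
  rw [← hΔ, ← hV]
  exact hu.weak_eq _ (χ.contDiff.mul hψ) χ.hasCompactSupport.mul_right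

theorem IsWeakSolution.integral_mul_cexp (hu : IsWeakSolution V u)
    (hR : ∀ᵐ x, R < ‖x‖ → u x = 0) {ι : Type*} [Fintype ι]
    (b : OrthonormalBasis ι ℝ (EuclideanSpace ℝ (Fin n))) (ℓ : EuclideanSpace ℝ (Fin n) →L[ℝ] ℂ) :
    -((∑ i, ℓ (b i) ^ 2) * ∫ x, (u x : ℂ) * Complex.exp (ℓ x)) =
      ∫ x, ((V x * u x : ℝ) : ℂ) * Complex.exp (ℓ x) := by
  have hexp {k : WithTop ℕ∞} : ContDiff ℝ k fun x => Complex.exp (ℓ x) := ℓ.contDiff.cexp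
  have hcont : Continuous fun x => Complex.exp (ℓ x) := (hexp (k := 0)).continuous
  have hVuR : ∀ᵐ x, R < ‖x‖ → V x * u x = 0 :=
    hR.mono fun x hx hxR => by rw [hx hxR, mul_zero]
  have hint := integrable_ofReal_mul_of_ae_eq_zero hu.locallyIntegrable hR hcont
  have hint' := integrable_ofReal_mul_of_ae_eq_zero hu.locallyIntegrable_mul hVuR hcont
  set σ : ℂ := ∑ i, ℓ (b i) ^ 2
  have htest (l : ℂ →L[ℝ] ℝ) : l (-(σ * ∫ x, (u x : ℂ) * Complex.exp (ℓ x))) =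
      l (∫ x, ((V x * u x : ℝ) : ℂ) * Complex.exp (ℓ x)) := by
    have hΔ (x) : Δ (l ∘ fun x => Complex.exp (ℓ x)) x = l (σ * Complex.exp (ℓ x)) := by
      rw [hexp.contDiffAt.laplacian_CLM_comp_left, Function.comp_apply, laplacian_cexp_clm b]
    have hreal (c : ℝ) (z : ℂ) : l ((c : ℂ) * z) = c * l z := by
      rw [← Complex.real_smul, map_smul, smul_eq_mul]
    rw [map_neg, ← integral_const_mul, ← l.integral_comp_comm (hint.const_mul σ),
      ← l.integral_comp_comm hint']
    simpa only [hΔ, mul_left_comm σ, hreal, Function.comp_apply] using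
      hu.weak_eq_of_contDiff hR (l.contDiff.comp hexp)
  exact Complex.ext (htest Complex.reCLM) (htest Complex.imCLM)

theorem IsWeakSolution.abs_inner_mul_norm_fourier_expWeighted_le (hu : IsWeakSolution V u)
    (hR : ∀ᵐ x, R < ‖x‖ → u x = 0) (a ξ : EuclideanSpace ℝ (Fin n)) :
    4 * Real.pi * |inner ℝ a ξ| * ‖𝓕 (expWeighted a u) ξ‖ ≤
      ‖𝓕 (expWeighted a fun x => V x * u x) ξ‖ := by
  rw [fourier_expWeighted, fourier_expWeighted,
    ← hu.integral_mul_cexp hR (stdOrthonormalBasis ℝ _), norm_neg, norm_mul]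
  gcongr
  calc 4 * Real.pi * |inner ℝ a ξ| = |(∑ i, fourierLaplaceExponent a ξ _ ^ 2).im| := by
        rw [im_sum_sq_fourierLaplaceExponent, abs_neg, abs_mul,
          abs_of_pos (by positivity : 0 < 4 * Real.pi)]
    _ ≤ _ := Complex.abs_im_le_norm _

theorem IsWeakSolution.eLpNorm_expWeighted_le (hu : IsWeakSolution V u)
    (hR : ∀ᵐ x, R < ‖x‖ → u x = 0) (hu₂ : MemLp u 2 (volume.restrict (closedBall 0 R)))
    (hVu₂ : MemLp (fun x => V x * u x) 2 (volume.restrict (closedBall 0 R)))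
    {e : EuclideanSpace ℝ (Fin n)} (he : 2 * R < ‖e‖) {τ : ℝ} (hτ : 0 < τ) :
    eLpNorm (expWeighted (τ • e) u) 2 volume ≤
      ENNReal.ofReal (2 * τ)⁻¹ * eLpNorm (expWeighted (τ • e) fun x => V x * u x) 2 volume := by
  have hVuR : ∀ᵐ x, R < ‖x‖ → V x * u x = 0 :=
    hR.mono fun x hx hxR => by rw [hx hxR, mul_zero]
  have hconst : (2 * τ)⁻¹ = 2 * Real.pi / (4 * Real.pi * τ) := by
    field_simp
    norm_num
  rw [hconst]
  refine eLpNorm_two_le_of_abs_inner_mul_norm_fourier_le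
    (integrable_expWeighted _ hu.locallyIntegrable hR) (memLp_expWeighted _ hu₂ hR)
    (integrable_expWeighted (τ • e) hu.locallyIntegrable_mul hVuR) (memLp_expWeighted _ hVu₂ hVuR)
    (hR.mono fun x hx hxR => ?_) he (by positivity) fun ξ => ?_
  · rw [expWeighted, hx hxR, Complex.ofReal_zero, zero_mul]
  · convert hu.abs_inner_mul_norm_fourier_expWeighted_le hR (τ • e) ξ using 2
    rw [real_inner_smul_left, abs_mul, abs_of_pos hτ, mul_assoc]

/-- The Carleman estimate with the weight of frequency `τ = M ≥ sup |V|` gives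
`‖e^τ u‖ ≤ (2 * τ)⁻¹ * ‖e^τ V u‖ ≤ ‖e^τ u‖ / 2`. -/
theorem IsWeakSolution.ae_eq_zero_of_ae_eq_zero_near_infinity (hn : 1 ≤ n) (hV : IsLinftyLoc V)
    (hu₂ : ∀ K, IsCompact K → MemLp u 2 (volume.restrict K)) (hu : IsWeakSolution V u)
    (hR : ∀ᵐ x, R < ‖x‖ → u x = 0) : u =ᵐ[volume] 0 := by
  have : Nonempty (Fin n) := ⟨⟨0, hn⟩⟩
  obtain ⟨e, he⟩ := NormedSpace.exists_lt_norm ℝ (EuclideanSpace ℝ (Fin n)) (2 * R)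
  obtain ⟨M, hM, hVM⟩ := exists_pos_ae_norm_le_of_memLp_top (hV.2 _ (isCompact_closedBall 0 R))
  have huball := hu₂ _ (isCompact_closedBall 0 R)
  have hVuball : MemLp (fun x => V x * u x) 2 (volume.restrict (closedBall 0 R)) := by
    refine huball.of_le_mul (c := M) (hV.1.restrict.mul huball.1) ?_
    filter_upwards [hVM] with x hx
    rw [norm_mul]
    gcongr
  set v := expWeighted (M • e) u
  have hv : MemLp v 2 volume := memLp_expWeighted _ huball hR
  have hVv : ∀ᵐ x, ‖expWeighted (M • e) (fun x => V x * u x) x‖ ≤ M * ‖v x‖ := by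
    filter_upwards [hR, (ae_restrict_iff' measurableSet_closedBall).1 hVM] with x hx hVx
    rw [norm_expWeighted, norm_expWeighted, abs_mul]
    rcases lt_or_ge R ‖x‖ with hlt | hle
    · simp [hx hlt]
    · rw [mul_assoc]
      gcongr
      exact hVx (mem_closedBall_zero_iff.2 hle)
  have hhalf : eLpNorm v 2 volume ≤ ENNReal.ofReal 2⁻¹ * eLpNorm v 2 volume :=
    calc eLpNorm v 2 volume
        ≤ ENNReal.ofReal (2 * M)⁻¹ * (ENNReal.ofReal M * eLpNorm v 2 volume) := by
          refine (hu.eLpNorm_expWeighted_le hR huball hVuball he hM).trans ?_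
          gcongr
          exact eLpNorm_le_mul_eLpNorm_of_ae_le_mul hVv 2
      _ = ENNReal.ofReal 2⁻¹ * eLpNorm v 2 volume := by
          rw [← mul_assoc, ← ENNReal.ofReal_mul (by positivity)]
          congr 2
          field_simp
  have hzero : eLpNorm v 2 volume = 0 := by
    by_contra hne
    have hreal := ENNReal.toReal_mono (ENNReal.mul_ne_top ENNReal.ofReal_ne_top hv.2.ne) hhalf
    rw [ENNReal.toReal_mul, ENNReal.toReal_ofReal (by norm_num)] at hreal
    linarith [ENNReal.toReal_pos hne hv.2.ne]
  filter_upwards [(eLpNorm_eq_zero_iff hv.1 two_ne_zero).1 hzero] with x hx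
  simpa [v, expWeighted] using hx

end UniqueContinuation

section ChangesSign

variable {n : ℕ} {V u : EuclideanSpace ℝ (Fin n) → ℝ}

theorem IsWeakSolution.neg (hu : IsWeakSolution V u) : IsWeakSolution V (-u) where
  locallyIntegrable := hu.locallyIntegrable.neg
  locallyIntegrable_mul := by
    simpa only [Pi.neg_apply, mul_neg] using! hu.locallyIntegrable_mul.neg
  weak_eq φ hφ hφs := by
    simp only [Pi.neg_apply, neg_mul, mul_neg, integral_neg, hu.weak_eq φ hφ hφs]

theorem changesSignNearInfinity_iff {f : EuclideanSpace ℝ (Fin n) → ℝ} :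
    ChangesSignNearInfinity f ↔ ¬ NonnegNearInfinity f ∧ ¬ NonposNearInfinity f := by
  simp only [ChangesSignNearInfinity, NonnegNearInfinity, NonposNearInfinity, ae_iff,
    Classical.not_imp, not_le, not_exists, pos_iff_ne_zero, forall_and]
  exact and_comm

end ChangesSign

theorem theorem1p4_general (n : ℕ) (hn : 1 ≤ n) (V : EuclideanSpace ℝ (Fin n) → ℝ)
    (hV : IsLinftyLoc V) (r : ℝ)
    (hV_inv : (∫⁻ x in {x : EuclideanSpace ℝ (Fin n) | r < ‖x‖},
      1 / ENNReal.ofReal (‖x‖ ^ (n + 2) * V x)) < ⊤)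
    (u : EuclideanSpace ℝ (Fin n) → ℝ)
    (hu₂ : ∀ K : Set (EuclideanSpace ℝ (Fin n)), IsCompact K → MemLp u 2 (volume.restrict K))
    (hu : IsWeakSolution V u) :
    (NonnegNearInfinity u ∨ NonposNearInfinity u → u =ᵐ[volume] 0) ∧
      (¬ u =ᵐ[volume] 0 → ChangesSignNearInfinity u) := by
  have hzero : NonnegNearInfinity u ∨ NonposNearInfinity u → u =ᵐ[volume] 0 := by
    rintro (hpos | ⟨R, hR⟩)
    · obtain ⟨R, hR⟩ := hu.exists_ae_eq_zero_of_nonnegNearInfinity hV hV_inv hpos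
      exact hu.ae_eq_zero_of_ae_eq_zero_near_infinity hn hV hu₂ hR
    · have hpos : NonnegNearInfinity (-u) :=
        ⟨R, hR.mono fun x hx hxR => neg_nonneg.2 (hx hxR)⟩
      obtain ⟨R', hR'⟩ := hu.neg.exists_ae_eq_zero_of_nonnegNearInfinity hV hV_inv hpos
      exact hu.ae_eq_zero_of_ae_eq_zero_near_infinity hn hV hu₂ <|
        hR'.mono fun x hx hxR => neg_eq_zero.1 (hx hxR)
  exact ⟨hzero, fun hne => changesSignNearInfinity_iff.2
    ⟨fun h => hne (hzero (.inl h)), fun h => hne (hzero (.inr h))⟩⟩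

/- The integrals of the nonnegative functions `1 / (|x|^(n+2) V)` and `|x|^(4-2n) V` are taken in
`[0, ∞]`, where `1 / 0 = ∞`. -/
theorem theorem1p4 (n : ℕ) (hn : 1 ≤ n) (V : EuclideanSpace ℝ (Fin n) → ℝ) (hV : IsLinftyLoc V)
    (r : ℝ) (hr : 0 < r) (hV_nonneg : ∀ᵐ x, r < ‖x‖ → 0 ≤ V x)
    (hV_inv : (∫⁻ x in {x : EuclideanSpace ℝ (Fin n) | r < ‖x‖},
      1 / ENNReal.ofReal (‖x‖ ^ (n + 2) * V x)) < ⊤)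
    (hV_int : (∫⁻ x in {x : EuclideanSpace ℝ (Fin n) | r < ‖x‖},
      ENNReal.ofReal (‖x‖ ^ (4 - 2 * (n : ℤ)) * V x)) = ⊤) :
    (∀ u : EuclideanSpace ℝ (Fin n) → ℝ, MemLp u ⊤ volume → IsWeakSolution V u →
      NonnegNearInfinity u ∨ NonposNearInfinity u → u =ᵐ[volume] 0) ∧
    (∀ u : EuclideanSpace ℝ (Fin n) → ℝ, MemLp u ⊤ volume → IsWeakSolution V u →
      (¬ ∃ c : ℝ, u =ᵐ[volume] fun _ => c) → ChangesSignNearInfinity u) := by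
  have hmain (u : EuclideanSpace ℝ (Fin n) → ℝ) (hub : MemLp u ⊤ volume) :=
    theorem1p4_general n hn V hV r hV_inv u fun K hK =>
      memLp_restrict_of_memLp_top hK (hub.restrict K) 2
  exact ⟨fun u hub hu => (hmain u hub hu).1,
    fun u hub hu hconst => (hmain u hub hu).2 fun h => hconst ⟨0, h⟩⟩
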